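/- Let $V:\mathbb R\to\mathbb R$ be real analytic with $V(x)/\log(1+|x|)\to+\infty$ as $x\to\pm\infty$, and let $\mu_0$ be the equilibrium measure in the external field $V$, i.e. the Borel probability measure on $\mathbb R$ that minimizes the logarithmic energy $$\iint \log\frac1{|s-t|}\,d\mu(s)\,d\mu(t)+\int V(t)\,d\mu(t)$$ among all Borel probability measures on $\mathbb R$ (the energy being understood in $(-\infty,+\infty]$ as $\iint\big(\log\frac1{|s-t|}+\tfrac12V(s)+\tfrac12V(t)\big)d\mu(s)d\mu(t)$). Let $k\ge1$ be an integer and let $x^*\in\operatorname{supp}\mu_0$. Suppose that in a neighbourhood of $x^*$ the measure $\mu_0$ has a density $\psi_0$ such that, for some $c_0>0$ and some function $h$ that is real analytic at $x^*$ with $h(x^*)=1$, one of the following holds for $s$ near $x^*$: (a) ($x^*$ is a singular interior point with exponent $2k$) $x^*$ is an interior point of $\operatorname{supp}\mu_0$ and $\psi_0(s)=c_0^{2k+1}(s-x^*)^{2k}h(s)$; (b) ($x^*$ is a singular right edge point with exponent $2k+\frac12$) $\psi_0(s)=c_0^{2k+3/2}(x^*-s)^{2k+1/2}h(s)$ for $s\le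 x^*$ and $\psi_0(s)=0$ for $s>x^*$; (b$'$) ($x^*$ is a singular left edge point with exponent $2k+\frac12$) $\psi_0(s)=c_0^{2k+3/2}(s-x^*)^{2k+1/2}h(s)$ for $s\ge x^*$ and $\psi_0(s)=0$ for $s<x^*$. Then for every $l=1,2,\dots,2k$ the function $s\mapsto (s-x^*)^{-l}$ is $\mu_0$-integrable and $$V^{(l)}(x^*)=-2\,(l-1)!\int\frac{d\mu_0(s)}{(s-x^*)^l}.$$ In particular, with $\tau_{\mathrm{crit}}:=\Big[\int\frac{d\mu_0(s)}{(x^*-s)^2}\Big]^{-1}$ and $x^*_\tau:=x^*+\tau\int\frac{d\mu_0(s)}{x^*-s}$, one has $\tau_{\mathrm{crit}}>0$, $V''(x^*)<0$, $$\tau_{\mathrm{crit}}=-\frac{2}{V''(x^*)},\qquad x^*_\tau=x^*+\frac{\tau}{2}V'(x^*)\quad\text{for all }\tau\in\mathbb R.$$ -/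

import Mathlib

open MeasureTheory Filter Topology

noncomputable section

namespace ExternalField

/-- An admissible external field: real analytic on the line, and growing faster than the logarithm
at both ends, `V(x) / log(1+|x|) → +∞` as `x → ±∞`. -/
structure IsAdmissible (V : ℝ → ℝ) : Prop where
  analytic : AnalyticOnNhd ℝ V Set.univ
  growth_atTop : Tendsto (fun x : ℝ => V x / Real.log (1 + |x|)) atTop atTop
  growth_atBot : Tendsto (fun x : ℝ => V x / Real.log (1 + |x|)) atBot atTop

/-- The symmetric energy kernel `log (1/|s-t|) + (V(s) + V(t))/2`, equal to `+∞` for `s = t`. -/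
def kernel (V : ℝ → ℝ) (s t : ℝ) : EReal :=
  -ENNReal.log (edist s t) + (((V s + V t) / 2 : ℝ) : EReal)

/-- The logarithmic energy `∬ log (1/|s-t|) dμ(s) dμ(t) + ∫ V dμ` in the external field `V`, with
values in `(-∞, +∞]`. The two terms are put under one double integral (`μ` has mass one), so that
the energy is defined for every probability measure: the kernel is bounded below for an admissible
field, hence the integral of its negative part is finite, while the two terms taken separately
could be `-∞` and `+∞`. -/
def energy (V : ℝ → ℝ) (μ : Measure ℝ) : EReal :=
  ((∫⁻ p : ℝ × ℝ, (kernel V p.1 p.2).toENNReal ∂(μ.prod μ) : ENNReal) : EReal) -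
    ((∫⁻ p : ℝ × ℝ, (-kernel V p.1 p.2).toENNReal ∂(μ.prod μ) : ENNReal) : EReal)

/-- `μ` is the equilibrium measure in the external field `V`: it minimizes the energy among all
Borel probability measures on the line. -/
structure IsEquilibriumMeasure (V : ℝ → ℝ) (μ : Measure ℝ) : Prop where
  isProbability : IsProbabilityMeasure μ
  minimizes : ∀ ν : Measure ℝ, IsProbabilityMeasure ν → energy V μ ≤ energy V ν

/-- `μ` has density `ψ` with respect to Lebesgue measure in a neighbourhood of `x`. -/
def HasDensityNear (μ : Measure ℝ) (ψ : ℝ → ℝ) (x : ℝ) : Prop :=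
  ∃ ε : ℝ, 0 < ε ∧ μ.restrict (Set.Ioo (x - ε) (x + ε)) =
    (volume.restrict (Set.Ioo (x - ε) (x + ε))).withDensity (fun s => ENNReal.ofReal (ψ s))

/-- `x` is a singular interior point with exponent `2k` of `μ`. -/
def IsSingularInteriorPoint (μ : Measure ℝ) (k : ℕ) (x : ℝ) : Prop :=
  1 ≤ k ∧ x ∈ interior μ.support ∧
    ∃ (c₀ : ℝ) (h : ℝ → ℝ), 0 < c₀ ∧ AnalyticAt ℝ h x ∧ h x = 1 ∧
      HasDensityNear μ (fun s => c₀ ^ (2 * k + 1) * (s - x) ^ (2 * k) * h s) x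

/-- `x` is a singular right edge point with exponent `2k + 1/2` of `μ`. -/
def IsSingularRightEdgePoint (μ : Measure ℝ) (k : ℕ) (x : ℝ) : Prop :=
  1 ≤ k ∧ x ∈ μ.support ∧
    ∃ (c₀ : ℝ) (h : ℝ → ℝ), 0 < c₀ ∧ AnalyticAt ℝ h x ∧ h x = 1 ∧
      HasDensityNear μ (fun s => if s ≤ x then
        c₀ ^ (2 * (k : ℝ) + 3 / 2) * (x - s) ^ (2 * (k : ℝ) + 1 / 2) * h s else 0) x

/-- `x` is a singular left edge point with exponent `2k + 1/2` of `μ`. -/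
def IsSingularLeftEdgePoint (μ : Measure ℝ) (k : ℕ) (x : ℝ) : Prop :=
  1 ≤ k ∧ x ∈ μ.support ∧
    ∃ (c₀ : ℝ) (h : ℝ → ℝ), 0 < c₀ ∧ AnalyticAt ℝ h x ∧ h x = 1 ∧
      HasDensityNear μ (fun s => if x ≤ s then
        c₀ ^ (2 * (k : ℝ) + 3 / 2) * (s - x) ^ (2 * (k : ℝ) + 1 / 2) * h s else 0) x

/-- `x` is a singular edge point with exponent `2k + 1/2` of `μ`, right or left. -/
def IsSingularEdgePoint (μ : Measure ℝ) (k : ℕ) (x : ℝ) : Prop :=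
  IsSingularRightEdgePoint μ k x ∨ IsSingularLeftEdgePoint μ k x

/-- The critical value `τ_crit = (∫ dμ(s) / (x - s)^2)⁻¹`. -/
def tauCrit (μ : Measure ℝ) (x : ℝ) : ℝ :=
  (∫ s, 1 / (x - s) ^ 2 ∂μ)⁻¹

/-- The shifted point `x_τ = x + τ ∫ dμ(s) / (x - s)`. -/
def shiftedPoint (μ : Measure ℝ) (x τ : ℝ) : ℝ :=
  x + τ * ∫ s, 1 / (x - s) ∂μ

end ExternalField

end

/-!
Comparing `μ` with `(1 + ε f) μ` for bounded `f` of mean zero shows that the logarithmic potential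
`∫ (log (1/|y - t|) + (V y + V t) / 2) dμ(t)` is constant for `μ`-almost every `y`. Such `y ≠ x`
accumulate at `x`, because `x` is in the support and is not an atom. Along them
`V y - b = 2 ∫ log |1 - (y - x) / (s - x)| dμ(s)` for a constant `b`, and the right side has the
formal expansion `-2 ∑ᵢ mᵢ (y - x) ^ i / i` with `mᵢ = ∫ (s - x) ^ (-i) dμ(s)`. When the density of
`μ` is `O(|s - x| ^ n)` at `x`, the expansion holds up to `o((y - x) ^ n)`: away from the
singularity `s = y` the remainder is dominated by a multiple of `|(y - x) / (s - x)| ^ n`, whose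
integral is finite, and near it rescaling gives `O(|y - x| ^ (n + 1))`. Comparing coefficients
with the Taylor polynomial of `V` at `x` gives the derivatives.
-/

namespace ExternalField

open Asymptotics Set

open scoped NNReal ENNReal

/-- The energy kernel `kernel V` as a real-valued function, for use with the Bochner integral. The
two agree off the diagonal; on it, `realKernel V s s = V s` is a junk value. -/
noncomputable def realKernel (V : ℝ → ℝ) (s t : ℝ) : ℝ :=
  (V s + V t) / 2 - Real.log |s - t|

lemma kernel_self (V : ℝ → ℝ) (s : ℝ) : kernel V s s = ⊤ := by
  simp [kernel]

lemma kernel_eq_coe_realKernel (V : ℝ → ℝ) {s t : ℝ} (h : s ≠ t) :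
    kernel V s t = (realKernel V s t : EReal) := by
  rw [kernel, realKernel, edist_dist, Real.dist_eq,
    ENNReal.log_ofReal_of_pos (abs_pos.2 (sub_ne_zero.2 h)), ← EReal.coe_neg, ← EReal.coe_add,
    neg_add_eq_sub]

lemma toENNReal_kernel (V : ℝ → ℝ) {s t : ℝ} (h : s ≠ t) :
    (kernel V s t).toENNReal = ENNReal.ofReal (realKernel V s t) := by
  rw [kernel_eq_coe_realKernel V h, EReal.toENNReal_of_ne_top (EReal.coe_ne_top _),
    EReal.toReal_coe]

lemma toENNReal_neg_kernel (V : ℝ → ℝ) {s t : ℝ} (h : s ≠ t) :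
    (-kernel V s t).toENNReal = ENNReal.ofReal (-realKernel V s t) := by
  rw [kernel_eq_coe_realKernel V h, ← EReal.coe_neg,
    EReal.toENNReal_of_ne_top (EReal.coe_ne_top _), EReal.toReal_coe]

lemma realKernel_comm (V : ℝ → ℝ) (s t : ℝ) : realKernel V s t = realKernel V t s := by
  rw [realKernel, realKernel, abs_sub_comm, add_comm (V s)]

lemma measurable_kernel {V : ℝ → ℝ} (hV : Measurable V) :
    Measurable fun p : ℝ × ℝ => kernel V p.1 p.2 := by
  unfold kernel
  fun_prop

lemma measurable_realKernel {V : ℝ → ℝ} (hV : Measurable V) :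
    Measurable fun p : ℝ × ℝ => realKernel V p.1 p.2 := by
  unfold realKernel
  fun_prop

lemma IsAdmissible.continuous {V : ℝ → ℝ} (hV : IsAdmissible V) : Continuous V :=
  continuousOn_univ.1 hV.analytic.continuousOn

lemma IsAdmissible.eventually_two_mul_log_le {V : ℝ → ℝ} (hV : IsAdmissible V) :
    ∀ᶠ s in cocompact ℝ, 2 * Real.log (1 + |s|) ≤ V s := by
  have hlog : ∀ᶠ s in cocompact ℝ, 0 < Real.log (1 + |s|) := by
    filter_upwards [(isCompact_singleton (x := (0 : ℝ))).compl_mem_cocompact] with s hs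
    exact Real.log_pos (lt_add_of_pos_right 1 (abs_pos.2 hs))
  have hratio : ∀ᶠ s in cocompact ℝ, 2 ≤ V s / Real.log (1 + |s|) := by
    rw [cocompact_eq_atBot_atTop, eventually_sup]
    exact ⟨hV.growth_atBot.eventually_ge_atTop 2, hV.growth_atTop.eventually_ge_atTop 2⟩
  filter_upwards [hlog, hratio] with s hs h
  exact (le_div_iff₀ hs).1 h

lemma log_abs_sub_le (s t : ℝ) :
    Real.log |s - t| ≤ Real.log (1 + |s|) + Real.log (1 + |t|) := by
  rw [← Real.log_mul (by positivity) (by positivity)]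
  rcases eq_or_ne s t with rfl | hst
  · rw [sub_self, abs_zero, Real.log_zero]
    exact Real.log_nonneg (by nlinarith [abs_nonneg s])
  · refine Real.log_le_log (abs_pos.2 (sub_ne_zero.2 hst)) ?_
    nlinarith [abs_sub s t, abs_nonneg s, abs_nonneg t]

lemma exists_le_realKernel {V : ℝ → ℝ} (hV : Continuous V)
    (hgrowth : ∀ᶠ s in cocompact ℝ, 2 * Real.log (1 + |s|) ≤ V s) :
    ∃ C, ∀ s t, C ≤ realKernel V s t := by
  have hcont : Continuous fun s => min (V s - 2 * Real.log (1 + |s|)) 0 := by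
    have : Continuous fun s : ℝ => Real.log (1 + |s|) :=
      Continuous.log (by fun_prop) fun s => by positivity
    fun_prop
  obtain ⟨s₀, hs₀⟩ := hcont.exists_forall_le' 0 <| by
    filter_upwards [hgrowth] with s hs
    rw [min_eq_right (sub_nonneg.2 hs)]
    exact min_le_right _ _
  refine ⟨min (V s₀ - 2 * Real.log (1 + |s₀|)) 0, fun s t => ?_⟩
  have hs := (hs₀ s).trans (min_le_left _ _)
  have ht := (hs₀ t).trans (min_le_left _ _)
  rw [realKernel]
  linarith [log_abs_sub_le s t]

lemma energy_eq_integral {V : ℝ → ℝ} {ν : Measure ℝ}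
    (hint : Integrable (fun p : ℝ × ℝ => realKernel V p.1 p.2) (ν.prod ν))
    (hne : ∀ᵐ p : ℝ × ℝ ∂(ν.prod ν), p.1 ≠ p.2) :
    energy V ν = ((∫ p : ℝ × ℝ, realKernel V p.1 p.2 ∂(ν.prod ν) : ℝ) : EReal) := by
  have hpos : ∫⁻ p : ℝ × ℝ, (kernel V p.1 p.2).toENNReal ∂(ν.prod ν) =
      ∫⁻ p : ℝ × ℝ, ENNReal.ofReal (realKernel V p.1 p.2) ∂(ν.prod ν) :=
    lintegral_congr_ae (hne.mono fun _ => toENNReal_kernel V)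
  have hneg : ∫⁻ p : ℝ × ℝ, (-kernel V p.1 p.2).toENNReal ∂(ν.prod ν) =
      ∫⁻ p : ℝ × ℝ, ENNReal.ofReal (-realKernel V p.1 p.2) ∂(ν.prod ν) :=
    lintegral_congr_ae (hne.mono fun _ => toENNReal_neg_kernel V)
  rw [energy, hpos, hneg, integral_eq_lintegral_pos_part_sub_lintegral_neg_part hint,
    EReal.coe_sub, EReal.coe_ennreal_toReal hint.lintegral_lt_top.ne]
  exact congrArg _ (EReal.coe_ennreal_toReal hint.neg.lintegral_lt_top.ne).symm

lemma lintegral_toENNReal_neg_kernel_ne_top {V : ℝ → ℝ} {C : ℝ}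
    (hC : ∀ s t, C ≤ realKernel V s t) (ν : Measure ℝ) [IsFiniteMeasure ν] :
    ∫⁻ p : ℝ × ℝ, (-kernel V p.1 p.2).toENNReal ∂(ν.prod ν) ≠ ⊤ := by
  have hle : ∀ p : ℝ × ℝ, (-kernel V p.1 p.2).toENNReal ≤ ENNReal.ofReal (-C) := by
    rintro ⟨s, t⟩
    rcases eq_or_ne s t with rfl | hst
    · simp [kernel_self]
    · rw [toENNReal_neg_kernel V hst]
      exact ENNReal.ofReal_le_ofReal (neg_le_neg (hC s t))
  refine ((lintegral_mono hle).trans_lt ?_).ne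
  rw [lintegral_const]
  exact ENNReal.mul_lt_top ENNReal.ofReal_lt_top (measure_lt_top _ _)

lemma lintegral_toENNReal_kernel_ne_top {V : ℝ → ℝ} {C : ℝ}
    (hC : ∀ s t, C ≤ realKernel V s t) {ν : Measure ℝ} [IsFiniteMeasure ν]
    (hE : energy V ν ≠ ⊤) :
    ∫⁻ p : ℝ × ℝ, (kernel V p.1 p.2).toENNReal ∂(ν.prod ν) ≠ ⊤ := by
  intro htop
  refine hE ?_
  rw [energy, htop, EReal.coe_ennreal_top, EReal.top_sub]
  exact EReal.coe_ennreal_eq_top_iff.not.2 (lintegral_toENNReal_neg_kernel_ne_top hC ν)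

lemma ae_fst_ne_snd_of_energy_ne_top {V : ℝ → ℝ} (hV : Measurable V) {C : ℝ}
    (hC : ∀ s t, C ≤ realKernel V s t) {ν : Measure ℝ} [IsFiniteMeasure ν]
    (hE : energy V ν ≠ ⊤) :
    ∀ᵐ p : ℝ × ℝ ∂(ν.prod ν), p.1 ≠ p.2 := by
  filter_upwards [ae_lt_top (measurable_kernel hV).ereal_toENNReal
    (lintegral_toENNReal_kernel_ne_top hC hE)] with p hp heq
  simp [heq, kernel_self] at hp

lemma enorm_eq_ofReal_add_ofReal_neg (r : ℝ) :
    ‖r‖ₑ = ENNReal.ofReal r + ENNReal.ofReal (-r) := by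
  rw [Real.enorm_eq_ofReal_abs]
  rcases le_total 0 r with hr | hr
  · rw [abs_of_nonneg hr, ENNReal.ofReal_of_nonpos (neg_nonpos.2 hr), add_zero]
  · rw [abs_of_nonpos hr, ENNReal.ofReal_of_nonpos hr, zero_add]

lemma integrable_realKernel_of_energy_ne_top {V : ℝ → ℝ} (hV : Measurable V) {C : ℝ}
    (hC : ∀ s t, C ≤ realKernel V s t) {ν : Measure ℝ} [IsFiniteMeasure ν]
    (hE : energy V ν ≠ ⊤) :
    Integrable (fun p : ℝ × ℝ => realKernel V p.1 p.2) (ν.prod ν) := by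
  refine ⟨(measurable_realKernel hV).aestronglyMeasurable, ?_⟩
  calc ∫⁻ p : ℝ × ℝ, ‖realKernel V p.1 p.2‖ₑ ∂(ν.prod ν)
      = ∫⁻ p : ℝ × ℝ, ((kernel V p.1 p.2).toENNReal + (-kernel V p.1 p.2).toENNReal)
          ∂(ν.prod ν) := by
        refine lintegral_congr_ae ?_
        filter_upwards [ae_fst_ne_snd_of_energy_ne_top hV hC hE] with p hp
        rw [toENNReal_kernel V hp, toENNReal_neg_kernel V hp, enorm_eq_ofReal_add_ofReal_neg]
    _ < ⊤ := by
        rw [lintegral_add_left (measurable_kernel hV).ereal_toENNReal]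
        exact ENNReal.add_lt_top.2 ⟨(lintegral_toENNReal_kernel_ne_top hC hE).lt_top,
          (lintegral_toENNReal_neg_kernel_ne_top hC ν).lt_top⟩

lemma ae_prod_fst_ne_snd (ν : Measure ℝ) [SFinite ν] [NullSingletonClass ν] :
    ∀ᵐ p : ℝ × ℝ ∂(ν.prod ν), p.1 ≠ p.2 := by
  refine (Measure.ae_prod_iff_ae_ae (p := fun p : ℝ × ℝ => p.1 ≠ p.2)
    (measurableSet_eq_fun measurable_fst measurable_snd).compl).2 ?_
  exact Eventually.of_forall fun s => (Measure.ae_ne ν s).mono fun _ => Ne.symm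

lemma integrableOn_log_abs_sub_Icc (a b : ℝ) :
    IntegrableOn (fun p : ℝ × ℝ => Real.log |p.1 - p.2|) (Icc a b ×ˢ Icc a b) := by
  have hlog : IntegrableOn Real.log (Icc (a - b) (b - a)) :=
    (integrableOn_Icc_iff_integrableOn_Ioc).2 intervalIntegral.intervalIntegrable_log'.1
  have hone : IntegrableOn (fun _ : ℝ => (1 : ℝ)) (Icc a b) := by simp
  have hconv := (hone.integrable_indicator measurableSet_Icc).convolution_integrand
    (ContinuousLinearMap.mul ℝ ℝ) (hlog.integrable_indicator measurableSet_Icc)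
  refine (hconv.integrableOn (s := Icc a b ×ˢ Icc a b)).congr_fun ?_
    (measurableSet_Icc.prod measurableSet_Icc)
  rintro ⟨s, t⟩ ⟨hs, ht⟩
  have hst : s - t ∈ Icc (a - b) (b - a) :=
    ⟨sub_le_sub hs.1 ht.2, sub_le_sub hs.2 ht.1⟩
  simp [indicator_of_mem ht, indicator_of_mem hst]

lemma integrableOn_realKernel_Icc {V : ℝ → ℝ} (hV : Continuous V) (a b : ℝ) :
    IntegrableOn (fun p : ℝ × ℝ => realKernel V p.1 p.2) (Icc a b ×ˢ Icc a b) := by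
  have hVi : IntegrableOn (fun p : ℝ × ℝ => (V p.1 + V p.2) / 2) (Icc a b ×ˢ Icc a b) :=
    Continuous.continuousOn (by fun_prop) |>.integrableOn_compact (isCompact_Icc.prod isCompact_Icc)
  exact hVi.sub (integrableOn_log_abs_sub_Icc a b)

lemma IsEquilibriumMeasure.energy_ne_top {V : ℝ → ℝ} (hV : Continuous V) {μ : Measure ℝ}
    (hμ : IsEquilibriumMeasure V μ) : energy V μ ≠ ⊤ := by
  have hint := integrableOn_realKernel_Icc hV 0 1
  rw [IntegrableOn, Measure.volume_eq_prod, ← Measure.prod_restrict] at hint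
  have hle := hμ.minimizes (volume.restrict (Icc 0 1)) ⟨by simp⟩
  rw [energy_eq_integral hint (ae_prod_fst_ne_snd _)] at hle
  exact (hle.trans_lt (EReal.coe_lt_top _)).ne

section EulerLagrange

variable {V : ℝ → ℝ} {μ : Measure ℝ}

lemma energy_withDensity_ofReal [SFinite μ]
    (hK : Integrable (fun p : ℝ × ℝ => realKernel V p.1 p.2) (μ.prod μ))
    (hne : ∀ᵐ p : ℝ × ℝ ∂(μ.prod μ), p.1 ≠ p.2) {w : ℝ → ℝ} (hw : Measurable w)
    (hw0 : ∀ s, 0 ≤ w s) {B : ℝ} (hwB : ∀ s, w s ≤ B) :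
    energy V (μ.withDensity fun s => ENNReal.ofReal (w s)) =
      ((∫ p : ℝ × ℝ, w p.1 * w p.2 * realKernel V p.1 p.2 ∂(μ.prod μ) : ℝ) : EReal) := by
  set ν := μ.withDensity fun s => ENNReal.ofReal (w s)
  have hprod : ν.prod ν = (μ.prod μ).withDensity fun p => ENNReal.ofReal (w p.1 * w p.2) := by
    simp_rw [ENNReal.ofReal_mul (hw0 _)]
    exact prod_withDensity (by fun_prop) (by fun_prop)
  have hwm : Measurable fun p : ℝ × ℝ => ENNReal.ofReal (w p.1 * w p.2) := by fun_prop
  have htop : ∀ᵐ p : ℝ × ℝ ∂(μ.prod μ), ENNReal.ofReal (w p.1 * w p.2) < ⊤ :=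
    Eventually.of_forall fun _ => ENNReal.ofReal_lt_top
  have htoReal : ∀ p : ℝ × ℝ, (ENNReal.ofReal (w p.1 * w p.2)).toReal = w p.1 * w p.2 :=
    fun p => ENNReal.toReal_ofReal (mul_nonneg (hw0 _) (hw0 _))
  have hint : Integrable (fun p : ℝ × ℝ => realKernel V p.1 p.2) (ν.prod ν) := by
    rw [hprod, integrable_withDensity_iff_integrable_smul' hwm htop]
    simp_rw [htoReal, smul_eq_mul]
    refine hK.bdd_mul (c := B * B) (by fun_prop) (Eventually.of_forall fun p => ?_)
    rw [Real.norm_of_nonneg (mul_nonneg (hw0 _) (hw0 _))]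
    exact mul_le_mul (hwB _) (hwB _) (hw0 _) ((hw0 _).trans (hwB p.1))
  have hνne : ∀ᵐ p : ℝ × ℝ ∂(ν.prod ν), p.1 ≠ p.2 :=
    hprod ▸ (withDensity_absolutelyContinuous _ _).ae_le hne
  rw [energy_eq_integral hint hνne, hprod,
    integral_withDensity_eq_integral_toReal_smul hwm htop]
  simp_rw [htoReal, smul_eq_mul]

lemma isProbabilityMeasure_withDensity_one_add [IsProbabilityMeasure μ] {f : ℝ → ℝ}
    (hf : Integrable f μ) (hf0 : ∫ s, f s ∂μ = 0) (hf1 : ∀ s, 0 ≤ 1 + f s) :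
    IsProbabilityMeasure (μ.withDensity fun s => ENNReal.ofReal (1 + f s)) := by
  refine ⟨?_⟩
  rw [withDensity_apply _ .univ, Measure.restrict_univ,
    ← ofReal_integral_eq_lintegral_ofReal ((integrable_const 1).fun_add hf)
    (Eventually.of_forall hf1), integral_add (integrable_const 1) hf, hf0]
  simp

lemma integral_one_add_mul_one_add_mul_realKernel [SFinite μ]
    (hK : Integrable (fun p : ℝ × ℝ => realKernel V p.1 p.2) (μ.prod μ)) {f : ℝ → ℝ}
    (hf : Measurable f) (hf1 : ∀ s, |f s| ≤ 1) (ε : ℝ) :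
    ∫ p : ℝ × ℝ, (1 + ε * f p.1) * (1 + ε * f p.2) * realKernel V p.1 p.2 ∂(μ.prod μ) =
      ∫ p : ℝ × ℝ, realKernel V p.1 p.2 ∂(μ.prod μ) +
        2 * ε * ∫ p : ℝ × ℝ, f p.1 * realKernel V p.1 p.2 ∂(μ.prod μ) +
        ε ^ 2 * ∫ p : ℝ × ℝ, f p.1 * (f p.2 * realKernel V p.1 p.2) ∂(μ.prod μ) := by
  have hf_fst : Measurable fun p : ℝ × ℝ => f p.1 := by fun_prop
  have hf_snd : Measurable fun p : ℝ × ℝ => f p.2 := by fun_prop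
  have hfst : Integrable (fun p : ℝ × ℝ => f p.1 * realKernel V p.1 p.2) (μ.prod μ) :=
    hK.bdd_mul (c := 1) hf_fst.aestronglyMeasurable (.of_forall fun p => hf1 p.1)
  have hsnd : Integrable (fun p : ℝ × ℝ => f p.2 * realKernel V p.1 p.2) (μ.prod μ) :=
    hK.bdd_mul (c := 1) hf_snd.aestronglyMeasurable (.of_forall fun p => hf1 p.2)
  have hboth : Integrable (fun p : ℝ × ℝ => f p.1 * (f p.2 * realKernel V p.1 p.2)) (μ.prod μ) :=
    hsnd.bdd_mul (c := 1) hf_fst.aestronglyMeasurable (.of_forall fun p => hf1 p.1)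
  have hsymm : ∫ p : ℝ × ℝ, f p.2 * realKernel V p.1 p.2 ∂(μ.prod μ) =
      ∫ p : ℝ × ℝ, f p.1 * realKernel V p.1 p.2 ∂(μ.prod μ) := by
    rw [← integral_prod_swap]
    simp only [Prod.fst_swap, Prod.snd_swap, realKernel_comm V]
  calc _ = ∫ p : ℝ × ℝ, (realKernel V p.1 p.2 + ε * (f p.1 * realKernel V p.1 p.2) +
        ε * (f p.2 * realKernel V p.1 p.2) +
        ε ^ 2 * (f p.1 * (f p.2 * realKernel V p.1 p.2))) ∂(μ.prod μ) :=
      integral_congr_ae (Eventually.of_forall fun p => by ring)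
    _ = _ := by
      have hadd₁ := hK.fun_add (hfst.const_mul ε)
      have hadd₂ := hadd₁.fun_add (hsnd.const_mul ε)
      rw [integral_add hadd₂ (hboth.const_mul (ε ^ 2)), integral_add hadd₁ (hsnd.const_mul ε),
        integral_add hK (hfst.const_mul ε)]
      simp only [integral_const_mul, hsymm]
      ring

lemma eq_zero_of_forall_le_add_mul_add_sq_mul {E A B : ℝ}
    (h : ∀ ε : ℝ, |ε| ≤ 1 → E ≤ E + 2 * ε * A + ε ^ 2 * B) : A = 0 := by
  have hmin : IsLocalMin (fun ε : ℝ => E + 2 * ε * A + ε ^ 2 * B) 0 := by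
    filter_upwards [Metric.closedBall_mem_nhds (0 : ℝ) one_pos] with ε hε
    simpa using h ε (by simpa using hε)
  have hderiv : HasDerivAt (fun ε : ℝ => E + 2 * ε * A + ε ^ 2 * B) (2 * A) 0 := by
    have hlin := ((hasDerivAt_id (0 : ℝ)).const_mul 2).mul_const A
    simpa using (hlin.const_add E).fun_add (((hasDerivAt_id (0 : ℝ)).pow 2).mul_const B)
  simpa using hmin.hasDerivAt_eq_zero hderiv

theorem IsEquilibriumMeasure.integral_mul_realKernel_eq_zero (hμ : IsEquilibriumMeasure V μ)
    (hK : Integrable (fun p : ℝ × ℝ => realKernel V p.1 p.2) (μ.prod μ))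
    (hne : ∀ᵐ p : ℝ × ℝ ∂(μ.prod μ), p.1 ≠ p.2) {f : ℝ → ℝ} (hf : Measurable f)
    (hf1 : ∀ s, |f s| ≤ 1) (hf0 : ∫ s, f s ∂μ = 0) :
    ∫ p : ℝ × ℝ, f p.1 * realKernel V p.1 p.2 ∂(μ.prod μ) = 0 := by
  have := hμ.isProbability
  have hfi : Integrable f μ :=
    .of_bound hf.aestronglyMeasurable 1 (Eventually.of_forall hf1)
  refine eq_zero_of_forall_le_add_mul_add_sq_mul
    (E := ∫ p : ℝ × ℝ, realKernel V p.1 p.2 ∂(μ.prod μ))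
    (B := ∫ p : ℝ × ℝ, f p.1 * (f p.2 * realKernel V p.1 p.2) ∂(μ.prod μ)) fun ε hε => ?_
  have hεf : ∀ s, |ε * f s| ≤ 1 := fun s => by
    rw [abs_mul]
    exact mul_le_one₀ hε (abs_nonneg _) (hf1 s)
  have hw0 : ∀ s, 0 ≤ 1 + ε * f s := fun s => by linarith [(abs_le.1 (hεf s)).1]
  have hmin := hμ.minimizes _ <| isProbabilityMeasure_withDensity_one_add (hfi.const_mul ε)
    (by rw [integral_const_mul, hf0, mul_zero]) hw0
  rw [energy_eq_integral hK hne, energy_withDensity_ofReal hK hne (by fun_prop) hw0 (B := 2)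
    fun s => by linarith [(abs_le.1 (hεf s)).2], EReal.coe_le_coe_iff] at hmin
  rwa [integral_one_add_mul_one_add_mul_realKernel hK hf hf1] at hmin

end EulerLagrange

lemma ae_eq_integral_of_forall_integral_mul_eq_zero {Ω : Type*} [MeasurableSpace Ω]
    {P : Measure Ω} [IsProbabilityMeasure P] {F : Ω → ℝ} (hF : Integrable F P)
    (h : ∀ f : Ω → ℝ, Measurable f → (∀ ω, |f ω| ≤ 1) → ∫ ω, f ω ∂P = 0 →
      ∫ ω, f ω * F ω ∂P = 0) :
    F =ᵐ[P] fun _ => ∫ ω, F ω ∂P := by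
  refine hF.ae_eq_of_forall_setIntegral_eq F _ (integrable_const _) fun A hA _ => ?_
  set f : Ω → ℝ := fun ω => A.indicator 1 ω - P.real A
  have hind : Integrable (A.indicator (1 : Ω → ℝ)) P := (integrable_const (1 : ℝ)).indicator hA
  have hf1 : ∀ ω, |f ω| ≤ 1 := fun ω => by
    have h0 : 0 ≤ P.real A := measureReal_nonneg
    have h1 : P.real A ≤ 1 := measureReal_le_one
    rw [abs_le]
    by_cases hω : ω ∈ A <;> simp only [f, hω, indicator_of_mem, indicator_of_notMem,
      not_false_eq_true, Pi.one_apply] <;> constructor <;> linarith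
  have hf0 : ∫ ω, f ω ∂P = 0 := by
    simp [f, integral_sub hind (integrable_const _), integral_indicator_one hA]
  have hfF : ∀ ω, f ω * F ω = A.indicator F ω - P.real A * F ω := fun ω => by
    by_cases hω : ω ∈ A <;> simp [f, hω, sub_mul]
  have hzero := h f ((measurable_one.indicator hA).sub_const _) hf1 hf0
  simp_rw [hfF] at hzero
  rw [integral_sub (hF.indicator hA) (hF.const_mul _), integral_indicator hA,
    integral_const_mul] at hzero
  rw [setIntegral_const, smul_eq_mul, sub_eq_zero.1 hzero]

theorem IsEquilibriumMeasure.exists_ae_integral_realKernel_eq {V : ℝ → ℝ} (hV : Continuous V)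
    {C : ℝ} (hC : ∀ s t, C ≤ realKernel V s t) {μ : Measure ℝ} (hμ : IsEquilibriumMeasure V μ) :
    ∃ c, ∀ᵐ s ∂μ, Integrable (fun t => realKernel V s t) μ ∧ ∫ t, realKernel V s t ∂μ = c := by
  have := hμ.isProbability
  have hE := hμ.energy_ne_top hV
  have hK := integrable_realKernel_of_energy_ne_top hV.measurable hC hE
  have hne := ae_fst_ne_snd_of_energy_ne_top hV.measurable hC hE
  refine ⟨∫ s, ∫ t, realKernel V s t ∂μ ∂μ, hK.prod_right_ae.and ?_⟩
  refine ae_eq_integral_of_forall_integral_mul_eq_zero hK.integral_prod_left fun f hf hf1 hf0 => ?_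
  have hf_fst : Measurable fun p : ℝ × ℝ => f p.1 := by fun_prop
  rw [← hμ.integral_mul_realKernel_eq_zero hK hne hf hf1 hf0, integral_prod _ <|
    hK.bdd_mul (c := 1) hf_fst.aestronglyMeasurable (.of_forall fun p => hf1 p.1)]
  simp only [integral_const_mul]

section DensityBound

variable {μ : Measure ℝ} {x : ℝ} {n : ℕ}

/-- Near `x` the measure `μ` has a density with respect to Lebesgue measure which is
`O(|s - x| ^ n)`, expressed by domination so that no density has to be named. -/
def HasDensityBound (μ : Measure ℝ) (x : ℝ) (n : ℕ) : Prop :=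
  ∃ r > 0, ∃ C : ℝ≥0, μ.restrict (Ioo (x - r) (x + r)) ≤
    (volume.restrict (Ioo (x - r) (x + r))).withDensity fun s => C * ‖s - x‖ₑ ^ n

lemma HasDensityNear.hasDensityBound {ψ : ℝ → ℝ} (h : HasDensityNear μ ψ x)
    (hψ : ψ =O[𝓝 x] fun s => (s - x) ^ n) : HasDensityBound μ x n := by
  obtain ⟨ε, hε, hdens⟩ := h
  obtain ⟨C, hC⟩ := hψ.bound
  obtain ⟨η, hη, hball⟩ := Metric.eventually_nhds_iff.1 hC
  have hsub : Ioo (x - min ε η) (x + min ε η) ⊆ Ioo (x - ε) (x + ε) :=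
    Ioo_subset_Ioo (by linarith [min_le_left ε η]) (by linarith [min_le_left ε η])
  refine ⟨min ε η, lt_min hε hη, C.toNNReal, ?_⟩
  rw [← Measure.restrict_restrict_of_subset hsub, hdens,
    restrict_withDensity measurableSet_Ioo, Measure.restrict_restrict_of_subset hsub]
  refine withDensity_mono ?_
  filter_upwards [ae_restrict_mem measurableSet_Ioo] with s hs
  have hψs : ‖ψ s‖ ≤ C * ‖(s - x) ^ n‖ := hball <| by
    rw [Real.dist_eq, abs_lt]
    constructor <;> linarith [hs.1, hs.2, min_le_right ε η]
  calc ENNReal.ofReal (ψ s) ≤ ENNReal.ofReal (C * ‖(s - x) ^ n‖) :=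
        ENNReal.ofReal_le_ofReal ((Real.le_norm_self _).trans hψs)
    _ = C.toNNReal * ‖s - x‖ₑ ^ n := by
        rw [ENNReal.ofReal_mul' (norm_nonneg _), ofReal_norm, enorm_pow]
        rfl

lemma HasDensityBound.mono (h : HasDensityBound μ x n) {j : ℕ} (hj : j ≤ n) :
    HasDensityBound μ x j := by
  obtain ⟨r, hr, C, hC⟩ := h
  refine ⟨r, hr, C * (r ^ (n - j)).toNNReal, hC.trans (withDensity_mono ?_)⟩
  filter_upwards [ae_restrict_mem measurableSet_Ioo] with s hs
  have hsr : ‖s - x‖ₑ ≤ ENNReal.ofReal r := by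
    rw [Real.enorm_eq_ofReal_abs]
    exact ENNReal.ofReal_le_ofReal (abs_le.2 ⟨by linarith [hs.1], by linarith [hs.2]⟩)
  calc C * ‖s - x‖ₑ ^ n = C * ‖s - x‖ₑ ^ (n - j) * ‖s - x‖ₑ ^ j := by
        rw [mul_assoc, ← pow_add, Nat.sub_add_cancel hj]
    _ ≤ C * ENNReal.ofReal r ^ (n - j) * ‖s - x‖ₑ ^ j := by gcongr
    _ = _ := by
        rw [← ENNReal.ofReal_pow hr.le, ENNReal.coe_mul]
        rfl

lemma HasDensityBound.eventually_measure_singleton_eq_zero (h : HasDensityBound μ x n) :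
    ∀ᶠ y in 𝓝 x, μ {y} = 0 := by
  obtain ⟨r, hr, C, hC⟩ := h
  filter_upwards [Ioo_mem_nhds (sub_lt_self x hr) (lt_add_of_pos_right x hr)] with y hy
  have hac : μ.restrict (Ioo (x - r) (x + r)) ≪ volume :=
    (Measure.absolutelyContinuous_of_le hC).trans
      ((withDensity_absolutelyContinuous _ _).trans Measure.restrict_le_self.absolutelyContinuous)
  rw [← inter_eq_left.2 (singleton_subset_iff.2 hy),
    ← Measure.restrict_apply (measurableSet_singleton y)]
  exact hac Real.volume_singleton

lemma integrable_one_div_pow_sub_of_integrableOn_Ioo [IsFiniteMeasure μ] {r : ℝ} (hr : 0 < r)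
    (h : IntegrableOn (fun s => 1 / (s - x) ^ n) (Ioo (x - r) (x + r)) μ) :
    Integrable (fun s => 1 / (s - x) ^ n) μ := by
  rw [← integrableOn_univ, ← union_compl_self (Ioo (x - r) (x + r))]
  refine h.union (IntegrableOn.of_bound (measure_lt_top _ _)
    (Measurable.aestronglyMeasurable (by fun_prop)) (1 / r ^ n) ?_)
  filter_upwards [ae_restrict_mem measurableSet_Ioo.compl] with s hs
  have hrs : r ≤ |s - x| := by
    by_contra! hlt
    exact hs ⟨by linarith [(abs_lt.1 hlt).1], by linarith [(abs_lt.1 hlt).2]⟩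
  rw [norm_div, norm_one, norm_pow, Real.norm_eq_abs]
  gcongr

lemma HasDensityBound.integrable_one_div_pow [IsFiniteMeasure μ] (h : HasDensityBound μ x n) :
    Integrable (fun s => 1 / (s - x) ^ n) μ := by
  obtain ⟨r, hr, C, hC⟩ := h
  have hle : ∀ s, C * ‖s - x‖ₑ ^ n * ‖1 / (s - x) ^ n‖ₑ ≤ C := fun s => by
    rw [mul_assoc, ← enorm_pow, ← enorm_mul]
    refine mul_le_of_le_one_right' ?_
    rcases eq_or_ne ((s - x) ^ n) 0 with h0 | h0
    · simp [h0]
    · rw [mul_one_div_cancel h0, enorm_one]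
  refine integrable_one_div_pow_sub_of_integrableOn_Ioo hr
    ⟨Measurable.aestronglyMeasurable (by fun_prop), ?_⟩
  calc ∫⁻ s in Ioo (x - r) (x + r), ‖1 / (s - x) ^ n‖ₑ ∂μ
      ≤ ∫⁻ s in Ioo (x - r) (x + r), C * ‖s - x‖ₑ ^ n * ‖1 / (s - x) ^ n‖ₑ :=
        (lintegral_mono' hC le_rfl).trans
          (lintegral_withDensity_le_lintegral_mul _ (by fun_prop) _)
    _ ≤ ∫⁻ _ in Ioo (x - r) (x + r), (C : ℝ≥0∞) := lintegral_mono hle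
    _ < ⊤ := by
        rw [setLIntegral_const]
        exact ENNReal.mul_lt_top ENNReal.coe_lt_top measure_Ioo_lt_top

lemma lintegral_comp_div_sub (f : ℝ → ℝ≥0∞) {δ : ℝ} (hδ : δ ≠ 0) (x : ℝ) :
    ∫⁻ s, f (δ / (s - x)) = ‖δ‖ₑ * ∫⁻ u, f u⁻¹ := by
  calc ∫⁻ s, f (δ / (s - x)) = ∫⁻ s, f (δ / s) :=
        lintegral_sub_right_eq_self (fun s => f (δ / s)) x
    _ = ‖δ‖ₑ * ∫⁻ u, f (δ / (δ * u)) := by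
        conv_lhs => rw [← Real.smul_map_volume_mul_left hδ]
        rw [lintegral_smul_measure, (measurableEmbedding_mulLeft₀ hδ).lintegral_map,
          ← Real.enorm_eq_ofReal_abs, smul_eq_mul]
    _ = ‖δ‖ₑ * ∫⁻ u, f u⁻¹ := by simp only [div_mul_cancel_left₀ hδ]

-- The integrand lives where `|s - x| ≤ 2 |δ|`: there the density bound contributes `|δ| ^ n`, and
-- the substitution `s = x + δ u` one more factor `|δ|`.
lemma HasDensityBound.exists_lintegral_comp_div_sub_le (h : HasDensityBound μ x n) {g : ℝ → ℝ}
    (hg0 : ∀ z, |z| ≤ 1 / 2 → g z = 0) (hg : ∫⁻ u, ‖g u⁻¹‖ₑ ≠ ⊤) :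
    ∃ K : ℝ≥0, ∀ᶠ δ in 𝓝[≠] 0, ∫⁻ s, ‖g (δ / (s - x))‖ₑ ∂μ ≤ K * ‖δ‖ₑ ^ (n + 1) := by
  obtain ⟨r, hr, C, hC⟩ := h
  refine ⟨C * 2 ^ n * (∫⁻ u, ‖g u⁻¹‖ₑ).toNNReal, ?_⟩
  filter_upwards [self_mem_nhdsWithin,
    nhdsWithin_le_nhds (Metric.ball_mem_nhds (0 : ℝ) (half_pos hr))] with δ hδ0 hδr
  rw [mem_ball_zero_iff, Real.norm_eq_abs] at hδr
  have hclose : ∀ s, g (δ / (s - x)) ≠ 0 → |s - x| ≤ 2 * |δ| := fun s hs => by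
    contrapose! hs
    refine hg0 _ ?_
    rw [abs_div, div_le_iff₀ (lt_of_le_of_lt (by positivity) hs)]
    linarith
  have hsupp : (Function.support fun s => ‖g (δ / (s - x))‖ₑ) ⊆ Ioo (x - r) (x + r) := by
    intro s hs
    have := abs_le.1 (hclose s (enorm_ne_zero.1 hs))
    exact ⟨by linarith, by linarith⟩
  have hle : ∀ s, C * ‖s - x‖ₑ ^ n * ‖g (δ / (s - x))‖ₑ ≤
      C * (2 * ‖δ‖ₑ) ^ n * ‖g (δ / (s - x))‖ₑ := fun s => by
    rcases eq_or_ne (g (δ / (s - x))) 0 with hs | hs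
    · simp [hs]
    · gcongr
      rw [Real.enorm_eq_ofReal_abs, Real.enorm_eq_ofReal_abs, ← ENNReal.ofReal_ofNat 2,
        ← ENNReal.ofReal_mul zero_le_two]
      exact ENNReal.ofReal_le_ofReal (hclose s hs)
  calc ∫⁻ s, ‖g (δ / (s - x))‖ₑ ∂μ = ∫⁻ s in Ioo (x - r) (x + r), ‖g (δ / (s - x))‖ₑ ∂μ :=
        (setLIntegral_eq_of_support_subset hsupp).symm
    _ ≤ ∫⁻ s in Ioo (x - r) (x + r), C * ‖s - x‖ₑ ^ n * ‖g (δ / (s - x))‖ₑ :=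
        (lintegral_mono' hC le_rfl).trans
          (lintegral_withDensity_le_lintegral_mul _ (by fun_prop) _)
    _ ≤ ∫⁻ s, C * (2 * ‖δ‖ₑ) ^ n * ‖g (δ / (s - x))‖ₑ :=
        (lintegral_mono hle).trans (setLIntegral_le_lintegral _ _)
    _ = C * (2 * ‖δ‖ₑ) ^ n * (‖δ‖ₑ * ∫⁻ u, ‖g u⁻¹‖ₑ) := by
        rw [lintegral_const_mul' _ _ (by finiteness), lintegral_comp_div_sub (fun z => ‖g z‖ₑ) hδ0]
    _ = _ := by
        rw [ENNReal.coe_mul, ENNReal.coe_toNNReal hg]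
        push_cast
        ring

end DensityBound

section IntegralAsymptotics

variable {μ : Measure ℝ} {x : ℝ} {n : ℕ} {φ : ℝ → ℝ} {B : ℝ}

lemma integrable_comp_div_sub (hint : Integrable (fun s => 1 / (s - x) ^ n) μ)
    (hφ : Measurable φ) (hB : ∀ z, |φ z| ≤ B * |z| ^ n) (δ : ℝ) :
    Integrable (fun s => φ (δ / (s - x))) μ := by
  refine (hint.norm.const_mul (B * |δ| ^ n)).mono'
    (hφ.comp (by fun_prop)).aestronglyMeasurable (Eventually.of_forall fun s => ?_)
  refine (hB _).trans_eq ?_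
  rw [abs_div, div_pow, norm_div, norm_one, norm_pow, Real.norm_eq_abs]
  ring

lemma isLittleO_integral_comp_div_sub_of_isLittleO (hint : Integrable (fun s => 1 / (s - x) ^ n) μ)
    (hφ : Measurable φ) (hB : ∀ z, |φ z| ≤ B * |z| ^ n) (h0 : φ =o[𝓝 0] fun z => z ^ n) :
    (fun δ => ∫ s, φ (δ / (s - x)) ∂μ) =o[𝓝[≠] 0] fun δ => δ ^ n := by
  have hne : ∀ᶠ δ : ℝ in 𝓝[≠] 0, δ ^ n ≠ 0 := by
    filter_upwards [self_mem_nhdsWithin] with δ hδ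
    exact pow_ne_zero n hδ
  rw [isLittleO_iff_tendsto' (hne.mono fun δ hδ h => absurd h hδ)]
  simp_rw [← integral_div]
  suffices hlim : Tendsto (fun δ => ∫ s, φ (δ / (s - x)) / δ ^ n ∂μ) (𝓝[≠] 0)
      (𝓝 (∫ _, (0 : ℝ) ∂μ)) by simpa only [integral_zero] using hlim
  refine tendsto_integral_filter_of_dominated_convergence (fun s => B * ‖1 / (s - x) ^ n‖)
    (Eventually.of_forall fun δ =>
      ((hφ.comp (by fun_prop)).div_const _).aestronglyMeasurable) ?_ (hint.norm.const_mul B)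
    (Eventually.of_forall fun s => ?_)
  · filter_upwards [hne] with δ hδ
    refine Eventually.of_forall fun s => ?_
    rw [norm_div, div_le_iff₀ (norm_pos_iff.2 hδ)]
    refine (hB _).trans_eq ?_
    rw [abs_div, div_pow, norm_div, norm_one, norm_pow, norm_pow, Real.norm_eq_abs,
      Real.norm_eq_abs]
    ring
  · have hδ : Tendsto (fun δ => δ / (s - x)) (𝓝[≠] 0) (𝓝 0) := by
      have hcont : Continuous fun δ => δ / (s - x) := by fun_prop
      simpa only [zero_div] using (hcont.tendsto 0).mono_left nhdsWithin_le_nhds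
    refine IsLittleO.tendsto_div_nhds_zero ((h0.comp_tendsto hδ).trans_isBigO ?_)
    simp_rw [Function.comp_def, div_pow, div_eq_mul_inv, mul_comm _ ((s - x) ^ n)⁻¹]
    exact (isBigO_refl _ _).const_mul_left _

lemma HasDensityBound.eventually_integrable_comp_div_sub (h : HasDensityBound μ x n)
    (hφ : Measurable φ) (hφ0 : ∀ z, |z| ≤ 1 / 2 → φ z = 0) (hφint : ∫⁻ u, ‖φ u⁻¹‖ₑ ≠ ⊤) :
    ∀ᶠ δ in 𝓝[≠] 0, Integrable (fun s => φ (δ / (s - x))) μ := by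
  obtain ⟨K, hK⟩ := h.exists_lintegral_comp_div_sub_le hφ0 hφint
  filter_upwards [hK] with δ hδ
  exact ⟨(hφ.comp (by fun_prop)).aestronglyMeasurable, hδ.trans_lt (by finiteness)⟩

lemma HasDensityBound.isLittleO_integral_comp_div_sub (h : HasDensityBound μ x n)
    (hφ0 : ∀ z, |z| ≤ 1 / 2 → φ z = 0) (hφint : ∫⁻ u, ‖φ u⁻¹‖ₑ ≠ ⊤) :
    (fun δ => ∫ s, φ (δ / (s - x)) ∂μ) =o[𝓝[≠] 0] fun δ => δ ^ n := by
  obtain ⟨K, hK⟩ := h.exists_lintegral_comp_div_sub_le hφ0 hφint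
  have hO : (fun δ => ∫ s, φ (δ / (s - x)) ∂μ) =O[𝓝[≠] 0] fun δ => δ ^ (n + 1) := by
    refine IsBigO.of_bound K ?_
    filter_upwards [hK] with δ hδ
    have hle := (enorm_integral_le_lintegral_enorm _).trans hδ
    rw [← enorm_pow] at hle
    exact NNReal.coe_le_coe.2 (ENNReal.coe_le_coe.1 hle)
  exact hO.trans_isLittleO ((isLittleO_pow_pow n.lt_succ_self).mono nhdsWithin_le_nhds)

end IntegralAsymptotics

section Log

/-- The part of `log |1 - z|` carrying the singularity at `z = 1`, and vanishing near `z = 0`. -/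
noncomputable def logSingularPart : ℝ → ℝ :=
  {z : ℝ | |1 - z| < 1 / 2}.indicator fun z => Real.log (1 - z)

/-- The remainder of order `n` at `z = 0` in the Taylor expansion of `log |1 - z|`, with the
singularity at `z = 1` cut out. -/
noncomputable def logRegularRemainder (n : ℕ) (z : ℝ) : ℝ :=
  Real.log (1 - z) - logSingularPart z + ∑ i ∈ Finset.range n, z ^ (i + 1) / ((i : ℝ) + 1)

lemma measurable_logSingularPart : Measurable logSingularPart :=
  Measurable.indicator (by fun_prop) (measurableSet_lt (by fun_prop) (by fun_prop))

lemma measurable_logRegularRemainder (n : ℕ) : Measurable (logRegularRemainder n) := by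
  have := measurable_logSingularPart
  unfold logRegularRemainder
  fun_prop

lemma logSingularPart_eq_zero {z : ℝ} (hz : |z| ≤ 1 / 2) : logSingularPart z = 0 :=
  indicator_of_notMem (s := {z | |1 - z| < 1 / 2}) (fun h => by
    linarith [(abs_lt.1 (show |1 - z| < 1 / 2 from h)).2, (abs_le.1 hz).2]) _

lemma log_one_sub_inv {u : ℝ} (hu : u ≠ 0) :
    Real.log (1 - u⁻¹) = Real.log (u - 1) - Real.log u := by
  rcases eq_or_ne u 1 with rfl | hu1
  · simp
  · rw [← Real.log_div (sub_ne_zero.2 hu1) hu, sub_div, div_self hu, one_div]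

lemma lintegral_logSingularPart_inv_ne_top : ∫⁻ u, ‖logSingularPart u⁻¹‖ₑ ≠ ⊤ := by
  have hlog : IntervalIntegrable Real.log volume (-1) 1 := intervalIntegral.intervalIntegrable_log'
  have hint : IntegrableOn (fun u => Real.log (u - 1) - Real.log u) (Ioc 0 2) := by
    refine IntegrableOn.sub ?_ intervalIntegral.intervalIntegrable_log'.1
    have := (hlog.comp_sub_right 1).1
    norm_num at this
    exact this
  have hle : ∀ u, ‖logSingularPart u⁻¹‖ₑ ≤
      (Ioc 0 2).indicator (fun u => ‖Real.log (u - 1) - Real.log u‖ₑ) u := fun u => by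
    by_cases hu : |1 - u⁻¹| < 1 / 2
    · have hu0 : 0 < u := inv_pos.1 (by linarith [(abs_lt.1 hu).2])
      have hu2 : u ≤ 2 := by
        rw [← inv_le_inv₀ two_pos hu0]
        linarith [(abs_lt.1 hu).2]
      rw [logSingularPart, indicator_of_mem (by exact hu), indicator_of_mem (mem_Ioc.2 ⟨hu0, hu2⟩),
        log_one_sub_inv hu0.ne']
    · rw [logSingularPart, indicator_of_notMem (by exact hu), enorm_zero]
      exact zero_le
  refine ((lintegral_mono hle).trans_lt ?_).ne
  rw [lintegral_indicator measurableSet_Ioc]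
  exact hint.2

lemma abs_logRegularRemainder_le_of_abs_le_half (n : ℕ) {z : ℝ} (hz : |z| ≤ 1 / 2) :
    |logRegularRemainder n z| ≤ 2 * |z| ^ (n + 1) := by
  have h := Real.abs_log_sub_add_sum_range_le (x := z) (by linarith) n
  rw [logRegularRemainder, logSingularPart_eq_zero hz, sub_zero, add_comm]
  refine h.trans ?_
  rw [div_le_iff₀ (by linarith)]
  nlinarith [pow_nonneg (abs_nonneg z) (n + 1)]

lemma isLittleO_logRegularRemainder (n : ℕ) : logRegularRemainder n =o[𝓝 0] fun z => z ^ n := by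
  have hO : logRegularRemainder n =O[𝓝 0] fun z => z ^ (n + 1) := by
    refine IsBigO.of_bound 2 ?_
    filter_upwards [Metric.closedBall_mem_nhds (0 : ℝ) one_half_pos] with z hz
    rw [norm_pow]
    exact abs_logRegularRemainder_le_of_abs_le_half n (mem_closedBall_zero_iff.1 hz)
  exact hO.trans_isLittleO (isLittleO_pow_pow n.lt_succ_self)

lemma abs_log_sub_logSingularPart_le {z : ℝ} (hz : 1 / 2 ≤ |z|) :
    |Real.log (1 - z) - logSingularPart z| ≤ 2 * |z| := by
  by_cases hw : |1 - z| < 1 / 2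
  · rw [logSingularPart, indicator_of_mem (by exact hw), sub_self, abs_zero]
    positivity
  · rw [logSingularPart, indicator_of_notMem (by exact hw), sub_zero, ← Real.log_abs]
    rw [not_lt] at hw
    have hpos : 0 < |1 - z| := one_half_pos.trans_le hw
    have hinv : |1 - z|⁻¹ ≤ 2 := by
      rw [inv_le_comm₀ hpos two_pos]
      linarith
    have habs : |1 - z| ≤ 1 + |z| := (abs_sub _ _).trans_eq (by rw [abs_one])
    rw [abs_le]
    constructor
    · linarith [Real.one_sub_inv_le_log_of_pos hpos]
    · linarith [Real.log_le_sub_one_of_pos hpos]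

lemma abs_sum_range_pow_div_le {z : ℝ} (hz : 1 / 2 ≤ |z|) (n : ℕ) :
    |∑ i ∈ Finset.range n, z ^ (i + 1) / ((i : ℝ) + 1)| ≤ n * (2 * |z|) ^ n := by
  have hterm : ∀ i ∈ Finset.range n, |z ^ (i + 1) / ((i : ℝ) + 1)| ≤ (2 * |z|) ^ n := by
    intro i hi
    have hi1 : (1 : ℝ) ≤ |(i : ℝ) + 1| := by
      rw [abs_of_nonneg (by positivity)]
      exact le_add_of_nonneg_left i.cast_nonneg
    calc |z ^ (i + 1) / ((i : ℝ) + 1)| ≤ |z| ^ (i + 1) := by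
          rw [abs_div, abs_pow]
          exact div_le_self (by positivity) hi1
      _ ≤ (2 * |z|) ^ (i + 1) := by gcongr; linarith
      _ ≤ (2 * |z|) ^ n := pow_le_pow_right₀ (by linarith) (Finset.mem_range.1 hi)
  calc |∑ i ∈ Finset.range n, z ^ (i + 1) / ((i : ℝ) + 1)|
      ≤ ∑ i ∈ Finset.range n, |z ^ (i + 1) / ((i : ℝ) + 1)| := Finset.abs_sum_le_sum_abs _ _
    _ ≤ ∑ _i ∈ Finset.range n, (2 * |z|) ^ n := Finset.sum_le_sum hterm
    _ = n * (2 * |z|) ^ n := by rw [Finset.sum_const, Finset.card_range, nsmul_eq_mul]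

lemma abs_logRegularRemainder_le {n : ℕ} (hn : 1 ≤ n) (z : ℝ) :
    |logRegularRemainder n z| ≤ (n + 1) * 2 ^ n * |z| ^ n := by
  have hB : (1 : ℝ) ≤ (n + 1) * 2 ^ n :=
    one_le_mul_of_one_le_of_one_le (le_add_of_nonneg_left n.cast_nonneg)
      (one_le_pow₀ one_le_two)
  rcases le_total |z| (1 / 2) with hz | hz
  · calc |logRegularRemainder n z| ≤ 2 * |z| ^ (n + 1) :=
          abs_logRegularRemainder_le_of_abs_le_half n hz
      _ = 2 * |z| * |z| ^ n := by ring
      _ ≤ (n + 1) * 2 ^ n * |z| ^ n :=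
          mul_le_mul_of_nonneg_right (by linarith) (by positivity)
  · calc |logRegularRemainder n z|
        ≤ 2 * |z| + n * (2 * |z|) ^ n :=
          (abs_add_le _ _).trans (add_le_add (abs_log_sub_logSingularPart_le hz)
            (abs_sum_range_pow_div_le hz n))
      _ ≤ (2 * |z|) ^ n + n * (2 * |z|) ^ n := by
          gcongr
          exact le_self_pow₀ (by linarith) (by omega)
      _ = (n + 1) * 2 ^ n * |z| ^ n := by ring

end Log

section LogPotential

variable {μ : Measure ℝ} [IsFiniteMeasure μ] {x : ℝ} {n : ℕ}

lemma log_one_sub_eq (n : ℕ) (z : ℝ) :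
    Real.log (1 - z) = logRegularRemainder n z + logSingularPart z -
      ∑ i ∈ Finset.range n, z ^ (i + 1) / ((i : ℝ) + 1) := by
  rw [logRegularRemainder]
  ring

lemma HasDensityBound.integrable_div_pow_div (h : HasDensityBound μ x n) (δ : ℝ) :
    ∀ i ∈ Finset.range n, Integrable (fun s => (δ / (s - x)) ^ (i + 1) / ((i : ℝ) + 1)) μ := by
  intro i hi
  refine ((h.mono (j := i + 1) (Finset.mem_range.1 hi)).integrable_one_div_pow.const_mul
    (δ ^ (i + 1) / ((i : ℝ) + 1))).congr (Eventually.of_forall fun s => ?_)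
  simp only [div_pow]
  ring

lemma HasDensityBound.eventually_integrable_log (h : HasDensityBound μ x n) (hn : 1 ≤ n) :
    ∀ᶠ δ in 𝓝[≠] 0, Integrable (fun s => Real.log (1 - δ / (s - x))) μ := by
  filter_upwards [h.eventually_integrable_comp_div_sub measurable_logSingularPart
    (fun _ => logSingularPart_eq_zero) lintegral_logSingularPart_inv_ne_top] with δ hδ
  simp_rw [log_one_sub_eq n]
  exact ((integrable_comp_div_sub h.integrable_one_div_pow (measurable_logRegularRemainder n)
    (abs_logRegularRemainder_le hn) δ).add hδ).sub
      (integrable_finsetSum _ (h.integrable_div_pow_div δ))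

theorem HasDensityBound.isLittleO_integral_log_add_sum (h : HasDensityBound μ x n) (hn : 1 ≤ n) :
    (fun δ => ∫ s, Real.log (1 - δ / (s - x)) ∂μ +
        ∑ i ∈ Finset.range n, (∫ s, 1 / (s - x) ^ (i + 1) ∂μ) / ((i : ℝ) + 1) * δ ^ (i + 1))
      =o[𝓝[≠] 0] fun δ => δ ^ n := by
  have hreg := integrable_comp_div_sub h.integrable_one_div_pow
    (measurable_logRegularRemainder n) (abs_logRegularRemainder_le hn)
  refine ((isLittleO_integral_comp_div_sub_of_isLittleO h.integrable_one_div_pow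
    (measurable_logRegularRemainder n) (abs_logRegularRemainder_le hn)
    (isLittleO_logRegularRemainder n)).add (h.isLittleO_integral_comp_div_sub
      (fun _ => logSingularPart_eq_zero) lintegral_logSingularPart_inv_ne_top)).congr' ?_ .rfl
  filter_upwards [h.eventually_integrable_comp_div_sub measurable_logSingularPart
    (fun _ => logSingularPart_eq_zero) lintegral_logSingularPart_inv_ne_top] with δ hsing
  have hsum : ∫ s, ∑ i ∈ Finset.range n, (δ / (s - x)) ^ (i + 1) / ((i : ℝ) + 1) ∂μ =
      ∑ i ∈ Finset.range n, (∫ s, 1 / (s - x) ^ (i + 1) ∂μ) / ((i : ℝ) + 1) * δ ^ (i + 1) := by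
    rw [integral_finsetSum _ (h.integrable_div_pow_div δ)]
    refine Finset.sum_congr rfl fun i _ => ?_
    rw [← integral_div, ← integral_mul_const]
    exact integral_congr_ae (Eventually.of_forall fun s => by simp only [div_pow]; ring)
  simp_rw [log_one_sub_eq n]
  rw [integral_sub ((hreg δ).fun_add hsing) (integrable_finsetSum _ (h.integrable_div_pow_div δ)),
    integral_add (hreg δ) hsing, hsum, sub_add_cancel]

end LogPotential

section TaylorUniqueness

open Polynomial

section Polynomial

variable {α 𝕜 : Type*} [NormedField 𝕜] {F : Filter α} [F.NeBot] {u : α → 𝕜} {n : ℕ} {p : 𝕜[X]}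

lemma coeff_zero_eq_zero_of_isLittleO_eval (hu : Tendsto u F (𝓝 0))
    (h : (fun a => p.eval (u a)) =o[F] fun a => u a ^ n) : p.coeff 0 = 0 := by
  have hlim : Tendsto (fun a => p.eval (u a)) F (𝓝 0) :=
    (isLittleO_one_iff 𝕜).1 (h.trans_isBigO ((hu.pow n).isBigO_one 𝕜))
  rw [coeff_zero_eq_eval_zero]
  exact tendsto_nhds_unique ((p.continuous.tendsto 0).comp hu) hlim

lemma coeff_eq_zero_of_isLittleO_eval (hu : Tendsto u F (𝓝[≠] 0))
    (h : (fun a => p.eval (u a)) =o[F] fun a => u a ^ n) : ∀ j ≤ n, p.coeff j = 0 := by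
  induction n generalizing p with
  | zero =>
    rintro j hj
    rw [Nat.le_zero.1 hj]
    exact coeff_zero_eq_zero_of_isLittleO_eval (tendsto_nhds_of_tendsto_nhdsWithin hu) h
  | succ n ih =>
    have hzero :=
      coeff_zero_eq_zero_of_isLittleO_eval (tendsto_nhds_of_tendsto_nhdsWithin hu) h
    have heval : ∀ z, p.eval z = z * p.divX.eval z := fun z => by
      conv_lhs => rw [← X_mul_divX_add p, hzero]
      simp
    have hdivX : (fun a => p.divX.eval (u a)) =o[F] fun a => u a ^ n := by
      simp_rw [heval, pow_succ'] at h
      refine ((isBigO_refl (fun a => (u a)⁻¹) F).mul_isLittleO h).congr' ?_ ?_ <;>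
      · filter_upwards [hu self_mem_nhdsWithin] with a ha
        exact inv_mul_cancel_left₀ ha _
    rintro (_ | j) hj
    · exact hzero
    · rw [← coeff_divX]
      exact ih hdivX j (Nat.le_of_succ_le_succ hj)

end Polynomial

lemma isLittleO_sub_sum_iteratedDeriv {f : ℝ → ℝ} {x : ℝ} {n : ℕ} (hf : ContDiffAt ℝ n f x) :
    (fun y => f y - ∑ j ∈ Finset.range (n + 1),
      iteratedDeriv j f x / j.factorial * (y - x) ^ j) =o[𝓝 x] fun y => (y - x) ^ n := by
  obtain ⟨s, hs, hfs⟩ := hf.contDiffOn le_rfl (by simp)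
  obtain ⟨r, hr, hrs⟩ := Metric.mem_nhds_iff.1 hs
  have htaylor := taylor_isLittleO (convex_ball x r) (Metric.mem_ball_self hr) (hfs.mono hrs)
  rw [Metric.isOpen_ball.nhdsWithin_eq (Metric.mem_ball_self hr)] at htaylor
  refine htaylor.congr_left fun y => congrArg (f y - ·) ?_
  rw [taylor_within_apply]
  refine Finset.sum_congr rfl fun j _ => ?_
  rw [iteratedDerivWithin_of_isOpen Metric.isOpen_ball (Metric.mem_ball_self hr), smul_eq_mul]
  ring

lemma tendsto_sub_nhdsNE (x : ℝ) : Tendsto (fun y => y - x) (𝓝[≠] x) (𝓝[≠] 0) := by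
  refine tendsto_nhdsWithin_iff.2 ⟨?_, eventually_mem_nhdsWithin.mono fun y => sub_ne_zero.2⟩
  simpa using ((continuous_sub_right x).tendsto x).mono_left nhdsWithin_le_nhds

theorem iteratedDeriv_eq_factorial_mul_coeff_of_isLittleO {f : ℝ → ℝ} {x : ℝ} {n : ℕ}
    (hf : ContDiffAt ℝ n f x) {F : Filter ℝ} [F.NeBot] (hF : F ≤ 𝓝[≠] x) {p : ℝ[X]}
    (h : (fun y => f y - p.eval (y - x)) =o[F] fun y => (y - x) ^ n) {l : ℕ} (hl : l ≤ n) :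
    iteratedDeriv l f x = l.factorial * p.coeff l := by
  set q : ℝ[X] := ∑ j ∈ Finset.range (n + 1), C (iteratedDeriv j f x / j.factorial) * X ^ j
  have hsub : (fun y => (p - q).eval (y - x)) =o[F] fun y => (y - x) ^ n := by
    refine (((isLittleO_sub_sum_iteratedDeriv hf).mono
      (hF.trans nhdsWithin_le_nhds)).sub h).congr_left fun y => ?_
    simp only [q, eval_sub, eval_finsetSum, eval_mul, eval_C, eval_pow, eval_X]
    ring
  have hq : q.coeff l = iteratedDeriv l f x / l.factorial := by
    simp only [q, finsetSum_coeff, coeff_C_mul_X_pow]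
    rw [Finset.sum_ite_eq, if_pos (Finset.mem_range.2 (Nat.lt_succ_of_le hl))]
  have hpq := coeff_eq_zero_of_isLittleO_eval ((tendsto_sub_nhdsNE x).mono_left hF) hsub l hl
  rw [coeff_sub, hq, sub_eq_zero] at hpq
  rw [hpq, mul_div_cancel₀ _ (Nat.cast_ne_zero.2 l.factorial_ne_zero)]

end TaylorUniqueness

lemma frequently_nhdsNE_of_mem_support {X : Type*} [TopologicalSpace X] [MeasurableSpace X]
    {μ : Measure X} {x : X} (hx : x ∈ μ.support) (h0 : μ {x} = 0) {P : X → Prop}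
    (hP : ∀ᵐ y ∂μ, P y) : ∃ᶠ y in 𝓝[≠] x, P y := by
  intro hnot
  have hpos := (Measure.mem_support_iff_forall x).1 hx _ (mem_nhdsWithin_iff_eventually.1 hnot)
  refine hpos.ne' (measure_mono_null (fun y hy => ?_) (measure_union_null h0 (ae_iff.1 hP)))
  exact or_iff_not_imp_left.2 hy

section Potential

variable {V : ℝ → ℝ} {μ : Measure ℝ} {x y : ℝ}

lemma realKernel_sub_realKernel (V : ℝ → ℝ) {t : ℝ} (hx : t ≠ x) (hy : t ≠ y) :
    realKernel V y t - realKernel V x t =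
      (V y - V x) / 2 - Real.log (1 - (y - x) / (t - x)) := by
  have hx0 : t - x ≠ 0 := sub_ne_zero.2 hx
  have hfac : 1 - (y - x) / (t - x) = (y - t) / (x - t) := by
    rw [← neg_sub t x, ← neg_sub t y]
    field_simp
    ring
  rw [hfac, Real.log_div (sub_ne_zero.2 hy.symm) (sub_ne_zero.2 hx.symm), realKernel, realKernel,
    Real.log_abs, Real.log_abs]
  ring

lemma sub_eq_two_mul_integral_realKernel_sub_add [IsProbabilityMeasure μ]
    (hx : μ {x} = 0) (hy : μ {y} = 0)
    (hlog : Integrable (fun t => Real.log (1 - (y - x) / (t - x))) μ)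
    (hK : Integrable (fun t => realKernel V y t) μ) :
    V y - V x = 2 * (∫ t, realKernel V y t ∂μ - ∫ t, realKernel V x t ∂μ +
      ∫ t, Real.log (1 - (y - x) / (t - x)) ∂μ) := by
  have hdiff : (fun t => realKernel V y t - realKernel V x t) =ᵐ[μ]
      fun t => (V y - V x) / 2 - Real.log (1 - (y - x) / (t - x)) := by
    filter_upwards [measure_eq_zero_iff_ae_notMem.1 hx, measure_eq_zero_iff_ae_notMem.1 hy]
      with t htx hty using realKernel_sub_realKernel V htx hty
  have hdiff_int := ((integrable_const ((V y - V x) / 2)).sub hlog).congr hdiff.symm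
  have hKx : Integrable (fun t => realKernel V x t) μ :=
    (hK.sub hdiff_int).congr (.of_forall fun t => sub_sub_cancel _ _)
  have := integral_congr_ae hdiff
  rw [integral_sub hK hKx, integral_sub (integrable_const _) hlog, integral_const,
    probReal_univ, one_smul] at this
  linarith

end Potential

section Equilibrium

open Polynomial

variable {V : ℝ → ℝ} {B : ℝ} {μ : Measure ℝ} {x : ℝ} {n : ℕ}

theorem IsEquilibriumMeasure.exists_isLittleO_sub_sum (hV : Continuous V)
    (hB : ∀ s t, B ≤ realKernel V s t) (hμ : IsEquilibriumMeasure V μ) (hx : x ∈ μ.support)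
    (h : HasDensityBound μ x n) (hn : 1 ≤ n) :
    ∃ F : Filter ℝ, F.NeBot ∧ F ≤ 𝓝[≠] x ∧ ∃ b : ℝ,
      (fun y => V y - (b - 2 * ∑ i ∈ Finset.range n,
        (∫ s, 1 / (s - x) ^ (i + 1) ∂μ) / ((i : ℝ) + 1) * (y - x) ^ (i + 1)))
        =o[F] fun y => (y - x) ^ n := by
  have := hμ.isProbability
  obtain ⟨c, hc⟩ := hμ.exists_ae_integral_realKernel_eq hV hB
  set G := {y | Integrable (fun t => realKernel V y t) μ ∧ ∫ t, realKernel V y t ∂μ = c}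
  have hsingle := h.eventually_measure_singleton_eq_zero
  refine ⟨𝓝[≠] x ⊓ 𝓟 G, frequently_mem_iff_neBot.1
    (frequently_nhdsNE_of_mem_support hx hsingle.self_of_nhds hc), inf_le_left,
    V x + 2 * (c - ∫ t, realKernel V x t ∂μ), ?_⟩
  have hlog := (h.isLittleO_integral_log_add_sum hn).comp_tendsto (tendsto_sub_nhdsNE x)
  refine ((hlog.mono inf_le_left).const_mul_left 2).congr' ?_ .rfl
  have hlog_int := (tendsto_sub_nhdsNE x).eventually (h.eventually_integrable_log hn)
  filter_upwards [mem_inf_of_left hlog_int, mem_inf_of_left (nhdsWithin_le_nhds hsingle),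
    mem_inf_of_right (mem_principal_self G)] with y hy_int hy ⟨hK, hKc⟩
  have hVy := sub_eq_two_mul_integral_realKernel_sub_add hsingle.self_of_nhds hy hy_int hK
  rw [hKc] at hVy
  simp only [Function.comp_apply]
  linarith

theorem IsEquilibriumMeasure.iteratedDeriv_eq (hV : Continuous V)
    (hB : ∀ s t, B ≤ realKernel V s t) (hμ : IsEquilibriumMeasure V μ) (hx : x ∈ μ.support)
    (h : HasDensityBound μ x n) (hVx : ContDiffAt ℝ n V x) {l : ℕ} (hl : 1 ≤ l) (hln : l ≤ n) :
    iteratedDeriv l V x = -2 * ((l - 1).factorial : ℝ) * ∫ s, 1 / (s - x) ^ l ∂μ := by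
  obtain ⟨F, hF, hFx, b, hb⟩ := hμ.exists_isLittleO_sub_sum hV hB hx h (hl.trans hln)
  set m : ℕ → ℝ := fun j => ∫ s, 1 / (s - x) ^ j ∂μ with hm
  set p : ℝ[X] := C b - X * ∑ i ∈ Finset.range n, C (2 * (m (i + 1) / (i + 1))) * X ^ i
  have hp : (fun y => V y - p.eval (y - x)) =o[F] fun y => (y - x) ^ n := by
    refine hb.congr_left fun y => ?_
    simp only [p, hm, eval_sub, eval_C, eval_mul, eval_X, eval_finsetSum, eval_pow,
      Finset.mul_sum, pow_succ']
    congr 2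
    exact Finset.sum_congr rfl fun i _ => by ring
  obtain ⟨i, rfl⟩ := Nat.exists_eq_add_of_le' hl
  have hcoeff : p.coeff (i + 1) = -(2 * (m (i + 1) / (i + 1))) := by
    simp only [p, coeff_sub, coeff_C_succ, coeff_X_mul, finsetSum_coeff, coeff_C_mul_X_pow]
    rw [Finset.sum_ite_eq, if_pos (Finset.mem_range.2 hln), zero_sub]
  rw [iteratedDeriv_eq_factorial_mul_coeff_of_isLittleO hVx hFx hp hln, hcoeff,
    Nat.factorial_succ, Nat.add_sub_cancel]
  push_cast
  field_simp
  simp only [hm]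

end Equilibrium

section SingularPoint

variable {μ : Measure ℝ} {k : ℕ} {x : ℝ}

/-- `x` is a singular point of `μ`, of interior type with exponent `2k` or of edge type with
exponent `2k + 1/2`, so that both types are treated at once. -/
def IsSingularPoint (μ : Measure ℝ) (k : ℕ) (x : ℝ) : Prop :=
  IsSingularInteriorPoint μ k x ∨ IsSingularEdgePoint μ k x

lemma IsSingularPoint.one_le (hx : IsSingularPoint μ k x) : 1 ≤ k := by
  rcases hx with hx | hx | hx <;> exact hx.1

lemma IsSingularPoint.mem_support (hx : IsSingularPoint μ k x) : x ∈ μ.support := by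
  rcases hx with hx | hx | hx
  exacts [interior_subset hx.2.1, hx.2.1, hx.2.1]

lemma isBigO_abs_sub_rpow (x : ℝ) {a : ℝ} {n : ℕ} (hn : n ≤ a) :
    (fun s => |s - x| ^ a) =O[𝓝 x] fun s => (s - x) ^ n := by
  refine IsBigO.of_bound' ?_
  filter_upwards [Metric.closedBall_mem_nhds x one_pos] with s hs
  rw [Real.norm_of_nonneg (by positivity), norm_pow, Real.norm_eq_abs, ← Real.rpow_natCast]
  exact Real.rpow_le_rpow_of_exponent_ge' (abs_nonneg _) hs n.cast_nonneg hn

lemma isBigO_const_mul_mul_of_continuousAt (c : ℝ) {f g h : ℝ → ℝ} (hf : f =O[𝓝 x] g)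
    (hh : ContinuousAt h x) : (fun s => c * f s * h s) =O[𝓝 x] g := by
  simpa only [mul_one] using (hf.const_mul_left c).mul (hh.isBigO_one ℝ)

lemma IsSingularPoint.hasDensityBound (hx : IsSingularPoint μ k x) :
    HasDensityBound μ x (2 * k) := by
  have hrpow : (fun s => |s - x| ^ (2 * (k : ℝ) + 1 / 2)) =O[𝓝 x] fun s => (s - x) ^ (2 * k) :=
    isBigO_abs_sub_rpow x (by push_cast; linarith)
  rcases hx with ⟨-, -, c₀, h, -, hh, -, hdens⟩ |
    ⟨-, -, c₀, h, -, hh, -, hdens⟩ | ⟨-, -, c₀, h, -, hh, -, hdens⟩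
  · exact hdens.hasDensityBound
      (isBigO_const_mul_mul_of_continuousAt _ (isBigO_refl _ _) hh.continuousAt)
  all_goals
    refine hdens.hasDensityBound ((IsBigO.of_bound' (.of_forall fun s => ?_)).trans
      (isBigO_const_mul_mul_of_continuousAt (c₀ ^ (2 * (k : ℝ) + 3 / 2)) hrpow hh.continuousAt))
    split_ifs with hs
  · rw [abs_sub_comm, abs_of_nonneg (sub_nonneg.2 hs)]
  · exact norm_zero.trans_le (norm_nonneg _)
  · rw [abs_of_nonneg (sub_nonneg.2 hs)]
  · exact norm_zero.trans_le (norm_nonneg _)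

lemma tauCrit_eq (μ : Measure ℝ) (x : ℝ) : tauCrit μ x = (∫ s, 1 / (s - x) ^ 2 ∂μ)⁻¹ := by
  simp only [tauCrit, sub_sq_comm]

lemma shiftedPoint_eq (μ : Measure ℝ) (x τ : ℝ) :
    shiftedPoint μ x τ = x - τ * ∫ s, 1 / (s - x) ∂μ := by
  have hneg : ∀ s, 1 / (x - s) = -(1 / (s - x)) := fun s => by rw [← neg_sub s x, div_neg]
  simp only [shiftedPoint, hneg, integral_neg, mul_neg, ← sub_eq_add_neg]

lemma integral_one_div_sub_sq_pos [IsProbabilityMeasure μ] (h0 : μ {x} = 0)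
    (hint : Integrable (fun s => 1 / (s - x) ^ 2) μ) : 0 < ∫ s, 1 / (s - x) ^ 2 ∂μ := by
  have hsupp : Function.support (fun s : ℝ => 1 / (s - x) ^ 2) = {x}ᶜ := by
    ext s
    simp [sub_eq_zero]
  rw [integral_pos_iff_support_of_nonneg (fun s => by positivity) hint, hsupp,
    (prob_compl_eq_one_iff (measurableSet_singleton x)).2 h0]
  exact one_pos

end SingularPoint

end ExternalField

open ExternalField in
theorem lemma1_general {V : ℝ → ℝ} (hV : Continuous V)
    (hgrowth : ∀ᶠ s in cocompact ℝ, 2 * Real.log (1 + |s|) ≤ V s)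
    {μ : Measure ℝ} (hμ : IsEquilibriumMeasure V μ) {n : ℕ} (hn : 2 ≤ n) {x : ℝ}
    (hVx : ContDiffAt ℝ n V x) (hx : x ∈ μ.support) (h : HasDensityBound μ x n) :
    (∀ l : ℕ, 1 ≤ l → l ≤ n → Integrable (fun s : ℝ => 1 / (s - x) ^ l) μ ∧
      iteratedDeriv l V x = -2 * ((l - 1).factorial : ℝ) * ∫ s, 1 / (s - x) ^ l ∂μ) ∧
    0 < tauCrit μ x ∧ iteratedDeriv 2 V x < 0 ∧ tauCrit μ x = -2 / iteratedDeriv 2 V x ∧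
    ∀ τ : ℝ, shiftedPoint μ x τ = x + τ / 2 * deriv V x := by
  have := hμ.isProbability
  obtain ⟨B, hB⟩ := exists_le_realKernel hV hgrowth
  have hderiv : ∀ l, 1 ≤ l → l ≤ n → iteratedDeriv l V x =
      -2 * ((l - 1).factorial : ℝ) * ∫ s, 1 / (s - x) ^ l ∂μ :=
    fun l => hμ.iteratedDeriv_eq hV hB hx h hVx
  have hpos : 0 < ∫ s, 1 / (s - x) ^ 2 ∂μ := integral_one_div_sub_sq_pos
    h.eventually_measure_singleton_eq_zero.self_of_nhds (h.mono hn).integrable_one_div_pow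
  have hderiv₁ : deriv V x = -2 * ∫ s, 1 / (s - x) ∂μ := by
    simpa using hderiv 1 le_rfl (one_le_two.trans hn)
  have hderiv₂ : iteratedDeriv 2 V x = -2 * ∫ s, 1 / (s - x) ^ 2 ∂μ := by
    simpa using hderiv 2 one_le_two hn
  refine ⟨fun l hl hln => ⟨(h.mono hln).integrable_one_div_pow, hderiv l hl hln⟩,
    tauCrit_eq μ x ▸ inv_pos.2 hpos, by linarith, ?_, fun τ => ?_⟩
  · rw [tauCrit_eq, hderiv₂, ← div_div, div_self (by norm_num), one_div]
  · rw [shiftedPoint_eq, hderiv₁]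
    ring

theorem lemma1 (V : ℝ → ℝ) (hV : ExternalField.IsAdmissible V)
    (μ₀ : Measure ℝ) (hμ₀ : ExternalField.IsEquilibriumMeasure V μ₀)
    (k : ℕ) (x : ℝ)
    (hx : ExternalField.IsSingularInteriorPoint μ₀ k x ∨
      ExternalField.IsSingularEdgePoint μ₀ k x) :
    (∀ l : ℕ, 1 ≤ l → l ≤ 2 * k →
      Integrable (fun s : ℝ => 1 / (s - x) ^ l) μ₀ ∧
      iteratedDeriv l V x =
        -2 * ((l - 1).factorial : ℝ) * ∫ s, 1 / (s - x) ^ l ∂μ₀) ∧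
    0 < ExternalField.tauCrit μ₀ x ∧
    iteratedDeriv 2 V x < 0 ∧
    ExternalField.tauCrit μ₀ x = -2 / iteratedDeriv 2 V x ∧
    ∀ τ : ℝ, ExternalField.shiftedPoint μ₀ x τ = x + τ / 2 * deriv V x := by
  have hx' : ExternalField.IsSingularPoint μ₀ k x := hx
  exact lemma1_general hV.continuous hV.eventually_two_mul_log_le hμ₀
    (Nat.le_mul_of_pos_right 2 hx'.one_le) (hV.analytic x trivial).contDiffAt hx'.mem_support
    hx'.hasDensityBound
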